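/- **Model.** Consider a call centre with four levels. For $i\in\{1,2,3,4\}$ there are $k_i\in\mathbb N$ level $i$ agents; level $i$ callers arrive at rate $\lambda_i$, a waiting level $i$ caller abandons at rate $\theta_i$ at cost $\gamma_i$, and a level $i$ agent serves a level $i$ caller at rate $\mu_i$; for $i\le 3$ a level $i+1$ agent serves a level $i$ caller at rate $\mu_i'$. All rates are non-negative reals, the costs are real. The capacity is $\ell\in\mathbb N$, and an arrival that finds the system full is blocked at cost $\beta$. Fix a reservation vector $\mathbf n=(n_2,n_3,n_4)$ with $n_i\in\{0,\dots,k_i\}$. A state is $z=(a,a_1,b,b_1,c,c_1,d)\in\mathbb Z^7$: $a,b,c,d$ are the numbers of level 1, 2, 3, 4 callers in the system, and $a_1,b_1,c_1$ the numbers of level 1, 2, 3 callers being served by level 2, 3, 4 agents. Let $\Omega$ be the set of states with $a,b,c,d\in\{0,\dots,\ell\}$, $a+b+c+d\le\ell$, $$\min(a-k_1,k_2-b-n_2)\mathbb 1_{a>k_1,\,b<k_2-n_2}\le a_1\le\min(k_2-n_2,a),$$ $$\min(b-k_2,k_3-c-n_3)\mathbb 1_{b>k_2,\,c<k_3-n_3}\le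 b_1\le\min(k_3-n_3,b),$$ $$\min(c-k_3,k_4-d-n_4)\mathbb 1_{c>k_3,\,d<k_4-n_4}\le c_1\le\min(k_4-n_4,c).$$ Put $$\begin{aligned} \iota_1&=\mathbb 1(a-a_1\ge k_1,\ b-b_1<k_2-n_2-a_1), & \kappa_1&=\mathbb 1(a-a_1>k_1,\ b-b_1=k_2-n_2-a_1),\\ \iota_2&=\mathbb 1(b-b_1\ge k_2,\ c-c_1<k_3-n_3-b_1), & \kappa_2&=\mathbb 1(b-b_1>k_2-a_1,\ c=k_3-n_3-b_1),\\ \iota_3&=\mathbb 1(c-c_1\ge k_3,\ d<k_4-n_4-c_1), & \kappa_2'&=\mathbb 1(b-b_1>k_2,\ c-c_1=k_3-n_3-b_1),\\ && \kappa_3&=\mathbb 1(c-c_1>k_3-b_1,\ d=k_4-n_4-c_1). \end{aligned}$$ In a state $z\in\Omega$ the following events occur, independently and at the stated rates. * Arrivals at rates $\lambda_1,\lambda_2,\lambda_3,\lambda_4$. If $a+b+c+d<\ell$ they lead to $(a+1,a_1+\iota_1,b,b_1,c,c_1,d)$, $(a,a_1,b+1,b_1+\iota_2,c,c_1,d)$,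 $(a,a_1,b,b_1,c+1,c_1+\iota_3,d)$ and $(a,a_1,b,b_1,c,c_1,d+1)$ respectively. If $a+b+c+d=\ell$ the state does not change and the cost is $\beta$. * Services: to $(a-1,a_1,b,b_1,c,c_1,d)$ at rate $\min(k_1,a-a_1)\mu_1$; to $(a-1,a_1-(1-\kappa_1),b,b_1,c,c_1,d)$ at rate $a_1\mu_1'$; to $(a,a_1+\kappa_1,b-1,b_1,c,c_1,d)$ at rate $\min(b-b_1,k_2-a_1)\mu_2$; to $(a,a_1,b-1,b_1-(1-\kappa_2),c,c_1,d)$ at rate $b_1\mu_2'$; to $(a,a_1,b,b_1+\kappa_2',c-1,c_1,d)$ at rate $\min(c-c_1,k_3-b_1)\mu_3$; to $(a,a_1,b,b_1,c-1,c_1-(1-\kappa_3),d)$ at rate $c_1\mu_3'$; to $(a,a_1,b,b_1,c,c_1+\kappa_3,d-1)$ at rate $\min(d,k_4-c_1)\mu_4$. * Abandonments: to $(a-1,a_1,b,b_1,c,c_1,d)$ at rate $w_1\theta_1$ and cost $\gamma_1$; to $(a,a_1,b-1,b_1,c,c_1,d)$ at rate $w_2\theta_2$ and cost $\gamma_2$;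 to $(a,a_1,b,b_1,c-1,c_1,d)$ at rate $w_3\theta_3$ and cost $\gamma_3$; to $(a,a_1,b,b_1,c,c_1,d-1)$ at rate $w_4\theta_4$ and cost $\gamma_4$. Here $w_1=\max(0,a-(k_1+a_1))$, $w_2=\max(0,b-(k_2-a_1+b_1))$, $w_3=\max(0,c-(k_3-b_1+c_1))$, $w_4=\max(0,d-(k_4-c_1))$. The system is followed as long as its state is in $\Omega$: nothing happens, and no cost arises, in a state outside $\Omega$. Let $A_z(\mathbf n,t)$ be the expected cost of abandonments and losses of this continuous-time Markov chain during $(0,t)$, given that it is in state $z$ at time $0$, and for $s\in\mathbb C$ with $\operatorname{Re}s>0$ let $\tilde A_z(\mathbf n,s)=\int_0^\infty e^{-st}A_z(\mathbf n,t)\,dt$. **Theorem.** For every $z$ and $t$ the sum of the costs in $(0,t)$ converges absolutely almost surely and is integrable, and for $\operatorname{Re}s>0$ the function $e^{-st}A_z(\mathbf n,t)$ of $t$ is integrable on $(0,\infty)$. For $\operatorname{Re}s>0$ and $z=(a,a_1,b,b_1,c,c_1,d)\in\Omega$, $$\tilde A_{a,a_1,b,b_1,c,c_1,d}(\mathbf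 n,s)=\frac{\xi_{a,a_1,b,b_1,c,c_1,d}(\mathbf n,s)}{\psi_{a,a_1,b,b_1,c,c_1,d}(s)},\qquad \psi_{a,a_1,b,b_1,c,c_1,d}(s)\ne0,$$ where (omitting the arguments $\mathbf n,s$ of $\tilde A$) $$\begin{aligned} \xi={}&\bigl(\lambda_1\tilde A_{a+1,a_1+\iota_1,b,b_1,c,c_1,d}+\lambda_2\tilde A_{a,a_1,b+1,b_1+\iota_2,c,c_1,d}+\lambda_3\tilde A_{a,a_1,b,b_1,c+1,c_1+\iota_3,d}+\lambda_4\tilde A_{a,a_1,b,b_1,c,c_1,d+1}\bigr)\mathbb 1_{a+b+c+d<\ell}\\ &+\min(k_1,a-a_1)\mu_1\tilde A_{a-1,a_1,b,b_1,c,c_1,d}+a_1\mu_1'\tilde A_{a-1,a_1-(1-\kappa_1),b,b_1,c,c_1,d}\\ &+\min(b-b_1,k_2-a_1)\mu_2\tilde A_{a,a_1+\kappa_1,b-1,b_1,c,c_1,d}+b_1\mu_2'\tilde A_{a,a_1,b-1,b_1-(1-\kappa_2),c,c_1,d}\\ &+\min(c-c_1,k_3-b_1)\mu_3\tilde A_{a,a_1,b,b_1+\kappa_2',c-1,c_1,d}+c_1\mu_3'\tilde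 A_{a,a_1,b,b_1,c-1,c_1-(1-\kappa_3),d}\\ &+\min(d,k_4-c_1)\mu_4\tilde A_{a,a_1,b,b_1,c,c_1+\kappa_3,d-1}\\ &+w_1\theta_1\bigl(\tilde A_{a-1,a_1,b,b_1,c,c_1,d}+\gamma_1/s\bigr)+w_2\theta_2\bigl(\tilde A_{a,a_1,b-1,b_1,c,c_1,d}+\gamma_2/s\bigr)\\ &+w_3\theta_3\bigl(\tilde A_{a,a_1,b,b_1,c-1,c_1,d}+\gamma_3/s\bigr)+w_4\theta_4\bigl(\tilde A_{a,a_1,b,b_1,c,c_1,d-1}+\gamma_4/s\bigr)\\ &+(\lambda_1+\lambda_2+\lambda_3+\lambda_4)\,\beta\,\mathbb 1_{a+b+c+d=\ell}/s,\\ \psi={}&(\lambda_1+\lambda_2+\lambda_3+\lambda_4)\mathbb 1_{a+b+c+d<\ell}+\min(k_1,a-a_1)\mu_1+a_1\mu_1'+\min(b-b_1,k_2-a_1)\mu_2+b_1\mu_2'\\ &+\min(c-c_1,k_3-b_1)\mu_3+c_1\mu_3'+\min(d,k_4-c_1)\mu_4+w_1\theta_1+w_2\theta_2+w_3\theta_3+w_4\theta_4+s.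 \end{aligned}$$ Moreover $\tilde A_{a,a_1,b,b_1,c,c_1,d}(\mathbf n,s)=0$ for every $(a,a_1,b,b_1,c,c_1,d)\in\mathbb Z^7\setminus\Omega$. -/

import Mathlib

open MeasureTheory ProbabilityTheory
open scoped ENNReal NNReal

noncomputable section

namespace FourLevel

/-- Parameters of the four-level call centre.  For `i = 1, 2, 3, 4`: `kᵢ` level `i` agents; arrival
rate `lamᵢ`, abandonment rate `thetaᵢ` and abandonment cost `gammaᵢ` of level `i` callers; service
rate `muᵢ` of a level `i` caller served by a level `i` agent; service rate `muUpᵢ` (for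
`i = 1, 2, 3`) of a level `i` caller served by a level `i + 1` agent.  `cap` is the total capacity
of the system and `beta` the blocking cost. -/
structure CallCentre where
  (k1 k2 k3 k4 : ℕ)
  (cap : ℕ)
  (lam1 lam2 lam3 lam4 : ℝ≥0)
  (mu1 mu2 mu3 mu4 : ℝ≥0)
  (muUp1 muUp2 muUp3 : ℝ≥0)
  (theta1 theta2 theta3 theta4 : ℝ≥0)
  (gamma1 gamma2 gamma3 gamma4 : ℝ)
  (beta : ℝ)

/-- A reservation vector `(n₂, n₃, n₄)`. -/
structure Reservation where
  (n2 n3 n4 : ℕ)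

/-- At most as many agents are reserved at a level as there are at that level. -/
def Reservation.Admissible (n : Reservation) (M : CallCentre) : Prop :=
  n.n2 ≤ M.k2 ∧ n.n3 ≤ M.k3 ∧ n.n4 ≤ M.k4

/-- A 7-tuple `(a, a₁, b, b₁, c, c₁, d)`: there are `a, b, c, d` callers of levels 1, 2, 3, 4, of
which `a₁, b₁, c₁` callers of levels 1, 2, 3 are being served by agents of levels 2, 3, 4. -/
@[ext]
structure State where
  (a a1 b b1 c c1 d : ℤ)

instance : Countable State := by
  have h : Function.Injective
      (fun z : State => (z.a, z.a1, z.b, z.b1, z.c, z.c1, z.d)) := by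
    intro x y h
    simp only [Prod.mk.injEq] at h
    obtain ⟨h1, h2, h3, h4, h5, h6, h7⟩ := h
    exact State.ext h1 h2 h3 h4 h5 h6 h7
  exact h.countable

instance : MeasurableSpace State := ⊤

instance : DiscreteMeasurableSpace State := ⟨fun _ => trivial⟩

/-- The indicator of a proposition, as an integer. -/
def ind (p : Prop) [Decidable p] : ℤ := if p then 1 else 0

/-- The total number of callers in the system. -/
def State.total (z : State) : ℤ := z.a + z.b + z.c + z.d

/-- The state space `Ω`. -/
def stateSpace (M : CallCentre) (n : Reservation) : Set State :=
  {z |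
    (0 ≤ z.a ∧ z.a ≤ M.cap) ∧ (0 ≤ z.b ∧ z.b ≤ M.cap) ∧
    (0 ≤ z.c ∧ z.c ≤ M.cap) ∧ (0 ≤ z.d ∧ z.d ≤ M.cap) ∧
    z.total ≤ M.cap ∧
    (min (z.a - M.k1) (M.k2 - z.b - n.n2) * ind (z.a > M.k1 ∧ z.b < M.k2 - n.n2) ≤ z.a1 ∧
      z.a1 ≤ min (M.k2 - n.n2 : ℤ) z.a) ∧
    (min (z.b - M.k2) (M.k3 - z.c - n.n3) * ind (z.b > M.k2 ∧ z.c < M.k3 - n.n3) ≤ z.b1 ∧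
      z.b1 ≤ min (M.k3 - n.n3 : ℤ) z.b) ∧
    (min (z.c - M.k3) (M.k4 - z.d - n.n4) * ind (z.c > M.k3 ∧ z.d < M.k4 - n.n4) ≤ z.c1 ∧
      z.c1 ≤ min (M.k4 - n.n4 : ℤ) z.c)}

/-- The events that can happen: a level `i` caller arrives (and is blocked if the system is full),
a level `i` caller is served by a level `i` agent, a level `i` caller is served by a level `i + 1`
agent, a waiting level `i` caller abandons. -/
inductive Event where
  | arrive1 | arrive2 | arrive3 | arrive4
  | serve1 | serve2 | serve3 | serve4
  | serveUp1 | serveUp2 | serveUp3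
  | abandon1 | abandon2 | abandon3 | abandon4
  deriving DecidableEq

instance : Fintype Event where
  elems := {.arrive1, .arrive2, .arrive3, .arrive4, .serve1, .serve2, .serve3, .serve4,
    .serveUp1, .serveUp2, .serveUp3, .abandon1, .abandon2, .abandon3, .abandon4}
  complete e := by cases e <;> decide

instance : Nonempty Event := ⟨.arrive1⟩

instance : MeasurableSpace Event := ⊤

instance : DiscreteMeasurableSpace Event := ⟨fun _ => trivial⟩

open Classical in
/-- The rate at which an event happens in the state `z`.  The system is followed only inside `Ω`:
outside `Ω` nothing happens.  (The integers below are nonnegative on `Ω`, so `Int.toNat` does not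
change them.) -/
def rate (M : CallCentre) (n : Reservation) (z : State) (e : Event) : ℝ≥0 :=
  if z ∈ stateSpace M n then
    match e with
    | .arrive1 => M.lam1
    | .arrive2 => M.lam2
    | .arrive3 => M.lam3
    | .arrive4 => M.lam4
    | .serve1 => (min (M.k1 : ℤ) (z.a - z.a1)).toNat * M.mu1
    | .serve2 => (min (z.b - z.b1) (M.k2 - z.a1)).toNat * M.mu2
    | .serve3 => (min (z.c - z.c1) (M.k3 - z.b1)).toNat * M.mu3
    | .serve4 => (min z.d (M.k4 - z.c1)).toNat * M.mu4
    | .serveUp1 => z.a1.toNat * M.muUp1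
    | .serveUp2 => z.b1.toNat * M.muUp2
    | .serveUp3 => z.c1.toNat * M.muUp3
    | .abandon1 => (max 0 (z.a - (M.k1 + z.a1))).toNat * M.theta1
    | .abandon2 => (max 0 (z.b - (M.k2 - z.a1 + z.b1))).toNat * M.theta2
    | .abandon3 => (max 0 (z.c - (M.k3 - z.b1 + z.c1))).toNat * M.theta3
    | .abandon4 => (max 0 (z.d - (M.k4 - z.c1))).toNat * M.theta4
  else 0

/-- The state to which an event leads from the state `z`. -/
def next (M : CallCentre) (n : Reservation) (z : State) : Event → State
  | .arrive1 => if z.total < M.cap then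
      ⟨z.a + 1, z.a1 + ind (z.a - z.a1 ≥ M.k1 ∧ z.b - z.b1 < M.k2 - n.n2 - z.a1),
        z.b, z.b1, z.c, z.c1, z.d⟩ else z
  | .arrive2 => if z.total < M.cap then
      ⟨z.a, z.a1,
        z.b + 1, z.b1 + ind (z.b - z.b1 ≥ M.k2 ∧ z.c - z.c1 < M.k3 - n.n3 - z.b1),
        z.c, z.c1, z.d⟩ else z
  | .arrive3 => if z.total < M.cap then
      ⟨z.a, z.a1, z.b, z.b1,
        z.c + 1, z.c1 + ind (z.c - z.c1 ≥ M.k3 ∧ z.d < M.k4 - n.n4 - z.c1), z.d⟩ else z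
  | .arrive4 => if z.total < M.cap then
      ⟨z.a, z.a1, z.b, z.b1, z.c, z.c1, z.d + 1⟩ else z
  | .serve1 => ⟨z.a - 1, z.a1, z.b, z.b1, z.c, z.c1, z.d⟩
  | .serveUp1 =>
      ⟨z.a - 1, z.a1 - (1 - ind (z.a - z.a1 > M.k1 ∧ z.b - z.b1 = M.k2 - n.n2 - z.a1)),
        z.b, z.b1, z.c, z.c1, z.d⟩
  | .serve2 =>
      ⟨z.a, z.a1 + ind (z.a - z.a1 > M.k1 ∧ z.b - z.b1 = M.k2 - n.n2 - z.a1),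
        z.b - 1, z.b1, z.c, z.c1, z.d⟩
  | .serveUp2 =>
      ⟨z.a, z.a1,
        z.b - 1, z.b1 - (1 - ind (z.b - z.b1 > M.k2 - z.a1 ∧ z.c = M.k3 - n.n3 - z.b1)),
        z.c, z.c1, z.d⟩
  | .serve3 =>
      ⟨z.a, z.a1,
        z.b, z.b1 + ind (z.b - z.b1 > M.k2 ∧ z.c - z.c1 = M.k3 - n.n3 - z.b1),
        z.c - 1, z.c1, z.d⟩
  | .serveUp3 =>
      ⟨z.a, z.a1, z.b, z.b1,
        z.c - 1, z.c1 - (1 - ind (z.c - z.c1 > M.k3 - z.b1 ∧ z.d = M.k4 - n.n4 - z.c1)), z.d⟩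
  | .serve4 =>
      ⟨z.a, z.a1, z.b, z.b1,
        z.c, z.c1 + ind (z.c - z.c1 > M.k3 - z.b1 ∧ z.d = M.k4 - n.n4 - z.c1), z.d - 1⟩
  | .abandon1 => ⟨z.a - 1, z.a1, z.b, z.b1, z.c, z.c1, z.d⟩
  | .abandon2 => ⟨z.a, z.a1, z.b - 1, z.b1, z.c, z.c1, z.d⟩
  | .abandon3 => ⟨z.a, z.a1, z.b, z.b1, z.c - 1, z.c1, z.d⟩
  | .abandon4 => ⟨z.a, z.a1, z.b, z.b1, z.c, z.c1, z.d - 1⟩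

/-- The cost of an event in the state `z`: `beta` for a blocked arrival, `gammaᵢ` for an
abandonment by a level `i` caller. -/
def cost (M : CallCentre) (z : State) : Event → ℝ
  | .arrive1 | .arrive2 | .arrive3 | .arrive4 => if z.total < M.cap then 0 else M.beta
  | .abandon1 => M.gamma1
  | .abandon2 => M.gamma2
  | .abandon3 => M.gamma3
  | .abandon4 => M.gamma4
  | _ => 0

/-- The total rate of events in the state `z`. -/
def totalRate (M : CallCentre) (n : Reservation) (z : State) : ℝ≥0 := ∑ e, rate M n z e

/-- The time until the next event in the state `z` is exponential with parameter `totalRate`, and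
infinite if that is zero. -/
def sojournLaw (M : CallCentre) (n : Reservation) (z : State) : Measure ℝ≥0∞ :=
  if totalRate M n z = 0 then Measure.dirac ⊤
  else (expMeasure (totalRate M n z)).map ENNReal.ofReal

instance (M : CallCentre) (n : Reservation) (z : State) :
    IsProbabilityMeasure (sojournLaw M n z) := by
  unfold sojournLaw
  split_ifs with h
  · infer_instance
  · have : IsProbabilityMeasure (expMeasure (totalRate M n z)) :=
      isProbabilityMeasure_expMeasure (by exact_mod_cast pos_iff_ne_zero.mpr h)
    exact Measure.isProbabilityMeasure_map ENNReal.measurable_ofReal.aemeasurable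

lemma tsum_rate (M : CallCentre) (n : Reservation) (z : State) :
    ∑' e, (rate M n z e : ℝ≥0∞) = totalRate M n z := by
  rw [tsum_fintype, totalRate, ENNReal.ofNNReal_finsetSum]

/-- The next event in the state `z` is `e` with probability `rate e / totalRate` (it never comes,
and an arbitrary label is used, if the total rate is zero). -/
def eventLaw (M : CallCentre) (n : Reservation) (z : State) : PMF Event :=
  if h : totalRate M n z = 0 then PMF.pure .arrive1
  else PMF.normalize (fun e => (rate M n z e : ℝ≥0∞))
    (by rw [tsum_rate]; exact_mod_cast h) (by rw [tsum_rate]; exact ENNReal.coe_ne_top)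

/-- One step of the process: the sojourn time before the next event, that event, and the state in
which it happens. -/
abbrev Step := ℝ≥0∞ × Event × State

/-- The law of the step that starts in the state `z`: sojourn time and event are independent. -/
def stepLaw (M : CallCentre) (n : Reservation) (z : State) : Measure Step :=
  (sojournLaw M n z).prod ((eventLaw M n z).toMeasure.prod (Measure.dirac z))

instance (M : CallCentre) (n : Reservation) (z : State) :
    IsProbabilityMeasure (stepLaw M n z) := by
  unfold stepLaw
  infer_instance

/-- The state after a step. -/
def stateAfter (M : CallCentre) (n : Reservation) (x : Step) : State := next M n x.2.2 x.2.1

lemma measurable_stateAfter (M : CallCentre) (n : Reservation) :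
    Measurable (stateAfter M n) :=
  (measurable_of_countable (fun y : Event × State => next M n y.2 y.1)).comp measurable_snd

/-- The Markov transition kernel: the next step starts in the state after the last one. -/
def stepKernel (M : CallCentre) (n : Reservation) (i : ℕ) :
    Kernel ((j : Finset.Iic i) → Step) Step :=
  (Kernel.ofFunOfCountable (stepLaw M n)).comap
    (fun h => stateAfter M n (h ⟨i, Finset.mem_Iic.mpr le_rfl⟩))
    ((measurable_stateAfter M n).comp (measurable_pi_apply _))

instance (M : CallCentre) (n : Reservation) (i : ℕ) : IsMarkovKernel (stepKernel M n i) := by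
  have : IsMarkovKernel (Kernel.ofFunOfCountable (stepLaw M n)) :=
    ⟨fun z => inferInstanceAs (IsProbabilityMeasure (stepLaw M n z))⟩
  unfold stepKernel
  infer_instance

/-- The law of the continuous-time Markov chain started in the state `z`, as the sequence of its
steps (jump chain, event labels and sojourn times). -/
def chainLaw (M : CallCentre) (n : Reservation) (z : State) : Measure (ℕ → Step) :=
  Kernel.trajMeasure (X := fun _ => Step) (stepLaw M n z) (stepKernel M n)

/-- The time of the event number `i` (the numbering starts with `0`). -/
def eventTime (ω : ℕ → Step) (i : ℕ) : ℝ≥0∞ := ∑ j ∈ Finset.range (i + 1), (ω j).1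

/-- The cost incurred by the event number `i` during the time interval `(0, t)`. -/
def costTerm (M : CallCentre) (t : ℝ) (ω : ℕ → Step) (i : ℕ) : ℝ :=
  if eventTime ω i < ENNReal.ofReal t then cost M (ω i).2.2 (ω i).2.1 else 0

/-- The cost of abandonments and losses during the time interval `(0, t)`. -/
def totalCost (M : CallCentre) (t : ℝ) (ω : ℕ → Step) : ℝ := ∑' i, costTerm M t ω i

/-- `A_z(n, t)`: the expected cost of abandonments and losses during the time interval `(0, t)`,
given that the state at time `0` is `z`. -/
def expectedCost (M : CallCentre) (n : Reservation) (z : State) (t : ℝ) : ℝ :=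
  ∫ ω, totalCost M t ω ∂(chainLaw M n z)

/-- The Laplace transform of a function on `(0, ∞)`. -/
def laplace (f : ℝ → ℝ) (s : ℂ) : ℂ := ∫ t in Set.Ioi (0 : ℝ), Complex.exp (-s * t) * f t

/-- The Laplace transform of `A_z(n, t)` in `t`. -/
def laplaceCost (M : CallCentre) (n : Reservation) (s : ℂ) (z : State) : ℂ :=
  laplace (expectedCost M n z) s

/-- The numerator `ξ`, in terms of a function `A` of the state. -/
def xi (M : CallCentre) (n : Reservation) (s : ℂ) (A : State → ℂ) : State → ℂ
  | ⟨a, a1, b, b1, c, c1, d⟩ =>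
    (M.lam1 * A ⟨a + 1, a1 + ind (a - a1 ≥ M.k1 ∧ b - b1 < M.k2 - n.n2 - a1), b, b1, c, c1, d⟩
      + M.lam2 * A ⟨a, a1, b + 1,
          b1 + ind (b - b1 ≥ M.k2 ∧ c - c1 < M.k3 - n.n3 - b1), c, c1, d⟩
      + M.lam3 * A ⟨a, a1, b, b1, c + 1, c1 + ind (c - c1 ≥ M.k3 ∧ d < M.k4 - n.n4 - c1), d⟩
      + M.lam4 * A ⟨a, a1, b, b1, c, c1, d + 1⟩) * ind (a + b + c + d < M.cap)
    + (min (M.k1 : ℤ) (a - a1) : ℤ) * M.mu1 * A ⟨a - 1, a1, b, b1, c, c1, d⟩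
    + a1 * M.muUp1 *
        A ⟨a - 1, a1 - (1 - ind (a - a1 > M.k1 ∧ b - b1 = M.k2 - n.n2 - a1)), b, b1, c, c1, d⟩
    + (min (b - b1) (M.k2 - a1) : ℤ) * M.mu2 *
        A ⟨a, a1 + ind (a - a1 > M.k1 ∧ b - b1 = M.k2 - n.n2 - a1), b - 1, b1, c, c1, d⟩
    + b1 * M.muUp2 *
        A ⟨a, a1, b - 1, b1 - (1 - ind (b - b1 > M.k2 - a1 ∧ c = M.k3 - n.n3 - b1)), c, c1, d⟩
    + (min (c - c1) (M.k3 - b1) : ℤ) * M.mu3 *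
        A ⟨a, a1, b, b1 + ind (b - b1 > M.k2 ∧ c - c1 = M.k3 - n.n3 - b1), c - 1, c1, d⟩
    + c1 * M.muUp3 *
        A ⟨a, a1, b, b1, c - 1, c1 - (1 - ind (c - c1 > M.k3 - b1 ∧ d = M.k4 - n.n4 - c1)), d⟩
    + (min d (M.k4 - c1) : ℤ) * M.mu4 *
        A ⟨a, a1, b, b1, c, c1 + ind (c - c1 > M.k3 - b1 ∧ d = M.k4 - n.n4 - c1), d - 1⟩
    + (max 0 (a - (M.k1 + a1)) : ℤ) * M.theta1 *
        (A ⟨a - 1, a1, b, b1, c, c1, d⟩ + M.gamma1 / s)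
    + (max 0 (b - (M.k2 - a1 + b1)) : ℤ) * M.theta2 *
        (A ⟨a, a1, b - 1, b1, c, c1, d⟩ + M.gamma2 / s)
    + (max 0 (c - (M.k3 - b1 + c1)) : ℤ) * M.theta3 *
        (A ⟨a, a1, b, b1, c - 1, c1, d⟩ + M.gamma3 / s)
    + (max 0 (d - (M.k4 - c1)) : ℤ) * M.theta4 *
        (A ⟨a, a1, b, b1, c, c1, d - 1⟩ + M.gamma4 / s)
    + (M.lam1 + M.lam2 + M.lam3 + M.lam4) * M.beta * ind (a + b + c + d = M.cap) / s

/-- The denominator `ψ`. -/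
def psi (M : CallCentre) (s : ℂ) : State → ℂ
  | ⟨a, a1, b, b1, c, c1, d⟩ =>
    (M.lam1 + M.lam2 + M.lam3 + M.lam4) * ind (a + b + c + d < M.cap)
    + (min (M.k1 : ℤ) (a - a1) : ℤ) * M.mu1 + a1 * M.muUp1
    + (min (b - b1) (M.k2 - a1) : ℤ) * M.mu2 + b1 * M.muUp2
    + (min (c - c1) (M.k3 - b1) : ℤ) * M.mu3 + c1 * M.muUp3
    + (min d (M.k4 - c1) : ℤ) * M.mu4
    + (max 0 (a - (M.k1 + a1)) : ℤ) * M.theta1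
    + (max 0 (b - (M.k2 - a1 + b1)) : ℤ) * M.theta2
    + (max 0 (c - (M.k3 - b1 + c1)) : ℤ) * M.theta3
    + (max 0 (d - (M.k4 - c1)) : ℤ) * M.theta4
    + s

end FourLevel

end

/-! The equation for the Laplace transform is first step analysis of a discounted chain. An event at
time `τ` with cost `c` contributes `c` to the cost in `(0, t)` exactly for `t > τ`, so its Laplace
transform is `c * exp (-s τ) / s`. Hence `laplaceCost` is `1 / s` times the sum over `i` of the
expected discounted cost of event `i` (`laplaceCost_eq_tsum`).

A step from `z` is discounted by `R / (R + s)` on average, `R` being the total rate, and event `e`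
has probability `rate e / R`; together this is the weight `rate e / (R + s)`. Separating the first
event from the series and multiplying by `R + s` gives the backward equation `laplaceCost_eq_sum`.
Outside `Ω` all rates vanish and it reads `s * laplaceCost = 0`; inside `Ω` it is rearranged into
`psi * laplaceCost = xi`.

Convergence comes from the finiteness of `Ω`: if `B` bounds all total rates, each step contracts
discounted expectations by at least the factor `B / (B + Re s) < 1` (`norm_discountedMean_le`). The
resulting geometric series excludes explosion and justifies every interchange of sum and integral.
-/

open MeasureTheory ProbabilityTheory
open scoped ENNReal NNReal

noncomputable section

namespace FourLevel

/-! ### Discounted expectations along the chain. -/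

section

/-- The discount factor `exp (-s τ)`, which is zero for `τ = ∞`. -/
def discount (s : ℂ) (τ : ℝ≥0∞) : ℂ := if τ = ⊤ then 0 else Complex.exp (-s * τ.toReal)

lemma discount_top (s : ℂ) : discount s ⊤ = 0 := by simp [discount]

lemma discount_add (s : ℂ) (τ υ : ℝ≥0∞) :
    discount s (τ + υ) = discount s τ * discount s υ := by
  by_cases h1 : τ = ⊤
  · simp [discount, h1]
  by_cases h2 : υ = ⊤
  · simp [discount, h2]
  simp only [discount, ENNReal.add_eq_top, h1, h2, or_self, if_false,
    ENNReal.toReal_add h1 h2, ← Complex.exp_add]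
  congr 1
  push_cast
  ring

@[fun_prop]
lemma measurable_discount (s : ℂ) : Measurable (discount s) := by
  unfold discount
  refine Measurable.ite (measurableSet_singleton ⊤) measurable_const ?_
  fun_prop

lemma norm_discount (s : ℂ) (τ : ℝ≥0∞) :
    ‖discount s τ‖ = if τ = ⊤ then 0 else Real.exp (-s.re * τ.toReal) := by
  unfold discount
  split_ifs <;> simp [Complex.norm_exp]

/-- This turns bounds on complex discounted means at a real argument into bounds on integrals of
norms. -/
lemma discount_ofReal_re (s : ℂ) (τ : ℝ≥0∞) :
    discount (s.re : ℂ) τ = (‖discount s τ‖ : ℂ) := by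
  rw [norm_discount, discount]
  split_ifs <;> simp

lemma norm_discount_le_one {s : ℂ} (hs : 0 < s.re) (τ : ℝ≥0∞) : ‖discount s τ‖ ≤ 1 := by
  rw [norm_discount]
  split_ifs
  · exact zero_le_one
  · rw [Real.exp_le_one_iff, neg_mul, neg_nonpos]
    positivity

lemma integral_exp_expMeasure {r : ℝ} (hr : 0 < r) {s : ℂ} (hs : 0 < s.re) :
    ∫ x, discount s (ENNReal.ofReal x) ∂(expMeasure r) = r / (r + s) := by
  have h1 : expMeasure r = volume.withDensity (exponentialPDF r) := rfl
  have hre : (-(r + s)).re < 0 := by simp; linarith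
  have hne : (r + s : ℂ) ≠ 0 := by
    intro h
    rw [h] at hre
    simp at hre
  rw [h1, integral_withDensity_eq_integral_toReal_smul
    (show Measurable (exponentialPDF r) from (measurable_exponentialPDFReal r).ennreal_ofReal)
    (by simp [exponentialPDF])]
  have h2 : ∀ x : ℝ, (exponentialPDF r x).toReal • discount s (ENNReal.ofReal x)
      = (Set.Ici (0 : ℝ)).indicator (fun x : ℝ => (r : ℂ) * Complex.exp (-(r + s) * x)) x := by
    intro x
    by_cases hx : 0 ≤ x
    · rw [Set.indicator_of_mem (show x ∈ Set.Ici (0 : ℝ) from hx),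
        exponentialPDF_of_nonneg hx, ENNReal.toReal_ofReal (by positivity), discount,
        if_neg ENNReal.ofReal_ne_top, ENNReal.toReal_ofReal hx, Complex.real_smul]
      push_cast
      rw [mul_assoc, ← Complex.exp_add]
      ring_nf
    · rw [Set.indicator_of_notMem (show x ∉ Set.Ici (0 : ℝ) from hx),
        exponentialPDF_of_neg (not_le.mp hx)]
      simp
  simp_rw [h2]
  rw [integral_indicator measurableSet_Ici, integral_Ici_eq_integral_Ioi,
    integral_const_mul, integral_exp_mul_complex_Ioi hre]
  simp only [Complex.ofReal_zero, mul_zero, Complex.exp_zero]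
  field_simp

variable (M : CallCentre) (n : Reservation)

lemma integral_discount_sojournLaw {s : ℂ} (hs : 0 < s.re) (z : State) :
    ∫ τ, discount s τ ∂(sojournLaw M n z) = totalRate M n z / (totalRate M n z + s) := by
  unfold sojournLaw
  split_ifs with h
  · simp [h, discount_top]
  · rw [integral_map ENNReal.measurable_ofReal.aemeasurable
      (measurable_discount s).aestronglyMeasurable,
      integral_exp_expMeasure (by exact_mod_cast pos_iff_ne_zero.mpr h) hs]

lemma eventLaw_apply {z : State} (h : totalRate M n z ≠ 0) (e : Event) :
    (eventLaw M n z e).toReal = rate M n z e / totalRate M n z := by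
  unfold eventLaw
  rw [dif_neg h, PMF.normalize_apply, tsum_rate, ENNReal.toReal_mul, ENNReal.toReal_inv,
    ENNReal.coe_toReal, ENNReal.coe_toReal, div_eq_mul_inv]

/-- The discounted expectation of `w` at the next event. -/
def discountedStep (s : ℂ) (w : Event × State → ℂ) (z : State) : ℂ :=
  ∑ e, (rate M n z e : ℂ) / (totalRate M n z + s) * w (e, z)

lemma rate_eq_zero {z : State} (h : totalRate M n z = 0) (e : Event) : rate M n z e = 0 := by
  have := Finset.sum_eq_zero_iff.mp h e (Finset.mem_univ e)
  exact this

/-- Independence of sojourn time and event splits the integral into `R / (R + s)` times the mean of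
`w` with weights `rate e / R`, and `R` cancels. For `R = 0` the sojourn is infinite, so the discount
is zero and the arbitrary event label does not matter. -/
lemma integral_stepLaw {s : ℂ} (hs : 0 < s.re) (w : Event × State → ℂ) (z : State) :
    ∫ x, discount s x.1 * w x.2 ∂(stepLaw M n z) = discountedStep M n s w z := by
  unfold stepLaw
  rw [integral_prod_mul, integral_discount_sojournLaw M n hs, Measure.prod_dirac,
    integral_map measurable_prodMk_right.aemeasurable
      (measurable_of_countable w).aestronglyMeasurable, PMF.integral_eq_sum, Finset.mul_sum,
    discountedStep]
  refine Finset.sum_congr rfl fun e _ => ?_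
  by_cases h : totalRate M n z = 0
  · simp [h, rate_eq_zero M n h e]
  · rw [eventLaw_apply M n h, Complex.real_smul]
    have h' : (totalRate M n z : ℂ) ≠ 0 := by exact_mod_cast h
    push_cast
    field_simp

/-- The discounted expectation of `w` at the event number `i`. -/
def discountedMean (s : ℂ) (w : Event × State → ℂ) (i : ℕ) (z : State) : ℂ :=
  ∫ ω, discount s (eventTime ω i) * w (ω i).2 ∂(chainLaw M n z)

instance (z : State) : IsProbabilityMeasure (chainLaw M n z) := by
  unfold chainLaw
  infer_instance

@[fun_prop]
lemma measurable_eventTime (i : ℕ) : Measurable fun ω : ℕ → Step => eventTime ω i := by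
  unfold eventTime
  fun_prop

lemma map_eval_zero_chainLaw (z : State) :
    (chainLaw M n z).map (fun ω => ω 0) = stepLaw M n z := by
  have h : (chainLaw M n z).map (Preorder.frestrictLe 0)
      = (stepLaw M n z).map (MeasurableEquiv.piUnique (fun _ : Finset.Iic 0 => Step)).symm := by
    unfold chainLaw Kernel.trajMeasure
    rw [Measure.map_comp _ _ (by fun_prop), Kernel.traj_map_frestrictLe, Kernel.partialTraj_self,
      Measure.id_comp]
  have h2 : (fun ω : ℕ → Step => ω 0)
      = (fun x : Finset.Iic 0 → Step => x ⟨0, by simp⟩) ∘ Preorder.frestrictLe 0 := rfl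
  rw [h2, ← Measure.map_map (by fun_prop) (by fun_prop), h, Measure.map_map (by fun_prop)
    (by fun_prop)]
  exact Measure.map_id

lemma map_chainLaw_succ (z : State) (i : ℕ) :
    (chainLaw M n z).map (fun ω => (Preorder.frestrictLe (π := fun _ => Step) i ω, ω (i + 1)))
      = (chainLaw M n z).map (Preorder.frestrictLe (π := fun _ => Step) i) ⊗ₘ stepKernel M n i :=
  Kernel.map_frestrictLe_trajMeasure_compProd_eq_map_trajMeasure.symm

lemma stepKernel_apply (i : ℕ) (h : (j : Finset.Iic i) → Step) :
    stepKernel M n i h =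
      stepLaw M n (stateAfter M n (h ⟨i, Finset.mem_Iic.mpr le_rfl⟩)) := rfl

lemma discountedMean_zero {s : ℂ} (hs : 0 < s.re) (w : Event × State → ℂ) :
    discountedMean M n s w 0 = discountedStep M n s w := by
  ext z
  have hw := measurable_of_countable w
  rw [← integral_stepLaw M n hs, ← map_eval_zero_chainLaw, integral_map
    (measurable_pi_apply 0).aemeasurable (by fun_prop), discountedMean]
  simp [eventTime]

/-- This peels off the last step: given the history up to step `i`, step `i + 1` has the law
`stepLaw` of the state reached, and the discount factor is multiplicative over the sojourn times.
The bound on `w` supplies the integrability needed to disintegrate. -/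
lemma discountedMean_succ {s : ℂ} (hs : 0 < s.re) {w : Event × State → ℂ} {C : ℝ}
    (hw : ∀ p, ‖w p‖ ≤ C) (i : ℕ) :
    discountedMean M n s w (i + 1) =
      discountedMean M n s (fun p => discountedStep M n s w (next M n p.2 p.1)) i := by
  ext z
  have hw' := measurable_of_countable w
  -- The event time as a function of the finite history alone, on which `stepKernel` acts.
  set T : (Finset.Iic i → Step) → ℝ≥0∞ := fun h => ∑ j, (h j).1 with hT
  have hTm : Measurable T := by fun_prop
  have hTe : ∀ ω : ℕ → Step, T (Preorder.frestrictLe i ω) = eventTime ω i := by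
    intro ω
    rw [hT, eventTime, Nat.range_succ_eq_Iic]
    exact Finset.sum_coe_sort (Finset.Iic i) (fun j => (ω j).1)
  set F : (Finset.Iic i → Step) × Step → ℂ :=
    fun p => discount s (T p.1) * (discount s p.2.1 * w p.2.2) with hF
  have hFm : Measurable F := by fun_prop
  have h1 : discountedMean M n s w (i + 1) z
      = ∫ p, F p ∂((chainLaw M n z).map
          (fun ω => (Preorder.frestrictLe (π := fun _ => Step) i ω, ω (i + 1)))) := by
    rw [integral_map (by fun_prop) hFm.aestronglyMeasurable, discountedMean]
    refine integral_congr_ae (.of_forall fun ω => ?_)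
    simp only [hF, hTe]
    rw [eventTime, Finset.sum_range_succ, discount_add, mul_assoc]
    rfl
  have hp : IsProbabilityMeasure
      ((chainLaw M n z).map (Preorder.frestrictLe (π := fun _ => Step) i)) :=
    Measure.isProbabilityMeasure_map (by fun_prop)
  have hFi : Integrable F
      ((chainLaw M n z).map (Preorder.frestrictLe (π := fun _ => Step) i) ⊗ₘ stepKernel M n i) := by
    refine Integrable.of_bound hFm.aestronglyMeasurable C (.of_forall fun p => ?_)
    have hC : 0 ≤ C := (norm_nonneg _).trans (hw p.2.2)
    rw [hF]
    simp only [norm_mul]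
    calc _ ≤ 1 * (1 * C) := by
          gcongr
          · exact norm_discount_le_one hs _
          · exact norm_discount_le_one hs _
          · exact hw _
      _ = C := by ring
  rw [h1, map_chainLaw_succ, Measure.integral_compProd hFi]
  simp only [hF, integral_const_mul, stepKernel_apply, integral_stepLaw M n hs]
  have hd := measurable_of_countable (discountedStep M n s w)
  have hst := measurable_stateAfter M n
  rw [integral_map (by fun_prop) (by fun_prop), discountedMean]
  simp only [hTe]
  rfl

end

/-! ### Summation under the integral and the transform of a unit cost. -/

section

/-- By Tonelli the sum of the norms has finite integral, hence is finite almost everywhere. It is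
used twice: on path space for `totalCost`, and on the time axis for `expectedCost`. -/
lemma ae_summable_and_integrable_tsum {α E : Type*} [MeasurableSpace α] {μ : Measure α}
    [NormedAddCommGroup E] [CompleteSpace E] {F : ℕ → α → E} (hF : ∀ i, Integrable (F i) μ)
    (hsum : Summable fun i => ∫ a, ‖F i a‖ ∂μ) :
    (∀ᵐ a ∂μ, Summable fun i => F i a) ∧ Integrable (fun a => ∑' i, F i a) μ := by
  have h1 : ∫⁻ a, ∑' i, ‖F i a‖ₑ ∂μ ≠ ⊤ := by
    rw [lintegral_tsum fun i => (hF i).1.enorm]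
    have : ∀ i, ∫⁻ a, ‖F i a‖ₑ ∂μ = ENNReal.ofReal (∫ a, ‖F i a‖ ∂μ) := fun i => by
      rw [ofReal_integral_norm_eq_lintegral_enorm (hF i)]
    simp_rw [this]
    exact hsum.tsum_ofReal_ne_top
  have h2 : ∀ᵐ a ∂μ, Summable fun i => F i a := by
    filter_upwards [ae_lt_top' (AEMeasurable.tsum fun i => (hF i).1.enorm) h1] with a ha
    refine Summable.of_norm ?_
    have := ENNReal.tsum_coe_ne_top_iff_summable.mp ha.ne
    exact NNReal.summable_coe.mpr this
  refine ⟨h2, ?_, ?_⟩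
  · refine aestronglyMeasurable_of_tendsto_ae Filter.atTop
      (fun k => Finset.aestronglyMeasurable_fun_sum (Finset.range k) fun i _ => (hF i).1) ?_
    filter_upwards [h2] with a ha
    exact ha.hasSum.tendsto_sum_nat
  · refine (lintegral_mono fun a => ?_).trans_lt h1.lt_top
    exact enorm_tsum_le_tsum_enorm

lemma integral_exp_indicator {s : ℂ} (hs : 0 < s.re) (τ : ℝ≥0∞) :
    ∫ t in Set.Ioi (0 : ℝ), (if τ < ENNReal.ofReal t then Complex.exp (-s * t) else 0)
      = discount s τ / s := by
  by_cases hτ : τ = ⊤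
  · simp [hτ, discount_top]
  have h : (fun t : ℝ => if τ < ENNReal.ofReal t then Complex.exp (-s * t) else 0)
      = (Set.Ioi τ.toReal).indicator (fun t : ℝ => Complex.exp (-s * t)) := by
    ext t
    simp [Set.indicator_apply, ENNReal.lt_ofReal_iff_toReal_lt hτ]
  have hsub : Set.Ioi (0 : ℝ) ∩ Set.Ioi τ.toReal = Set.Ioi τ.toReal :=
    Set.inter_eq_right.mpr (Set.Ioi_subset_Ioi ENNReal.toReal_nonneg)
  rw [h, setIntegral_indicator measurableSet_Ioi, hsub,
    integral_exp_mul_complex_Ioi (by simpa using hs), discount, if_neg hτ, neg_div_neg_eq]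

/-! ### Uniform bounds from the finite state space, and first step analysis. -/

variable (M : CallCentre) (n : Reservation)

variable {M n} in
/-- In a state of `Ω`, the numbers of callers served one level up are nonnegative, at most the
numbers of callers of the level in question and at most the numbers of unreserved agents. -/
lemma served_bounds {z : State} (hz : z ∈ stateSpace M n) :
    (0 ≤ z.a1 ∧ z.a1 ≤ z.a ∧ z.a1 ≤ M.k2 - n.n2) ∧
    (0 ≤ z.b1 ∧ z.b1 ≤ z.b ∧ z.b1 ≤ M.k3 - n.n3) ∧
    (0 ≤ z.c1 ∧ z.c1 ≤ z.c ∧ z.c1 ≤ M.k4 - n.n4) := by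
  obtain ⟨-, -, -, -, -, ha1, hb1, hc1⟩ := hz
  -- The lower bounds in `Ω` are nonnegative: where the indicator is 1, its condition makes both
  -- arguments of the minimum nonnegative.
  have hmul : ∀ (p q : ℤ) (P : Prop) [Decidable P], (P → 0 ≤ p ∧ 0 ≤ q) →
      0 ≤ min p q * ind P := by
    intro p q P _ h
    unfold ind
    split_ifs with hP
    · simpa using h hP
    · simp
  have h1 := (hmul _ _ _ (by omega)).trans ha1.1
  have h2 := (hmul _ _ _ (by omega)).trans hb1.1
  have h3 := (hmul _ _ _ (by omega)).trans hc1.1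
  omega

lemma finite_stateSpace : (stateSpace M n).Finite := by
  have hinj : Function.Injective
      (fun z : State => (z.a, z.a1, z.b, z.b1, z.c, z.c1, z.d)) := by
    intro x y h
    simp only [Prod.mk.injEq] at h
    obtain ⟨h1, h2, h3, h4, h5, h6, h7⟩ := h
    exact State.ext h1 h2 h3 h4 h5 h6 h7
  refine ((Set.finite_Icc (0 : ℤ × ℤ × ℤ × ℤ × ℤ × ℤ × ℤ)
    (M.cap, M.cap, M.cap, M.cap, M.cap, M.cap, M.cap)).preimage hinj.injOn).subset ?_
  intro z hz
  obtain ⟨⟨h1, h2, h3⟩, ⟨h4, h5, h6⟩, ⟨h7, h8, h9⟩⟩ := served_bounds hz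
  obtain ⟨ha, hb, hc, hd, -⟩ := hz
  simp only [Set.mem_preimage, Set.mem_Icc, Prod.le_def, Prod.fst_zero, Prod.snd_zero]
  omega

lemma exists_totalRate_le : ∃ B : ℝ≥0, ∀ z, totalRate M n z ≤ B := by
  obtain ⟨B, hB⟩ := ((finite_stateSpace M n).image (totalRate M n)).bddAbove
  refine ⟨B, fun z => ?_⟩
  by_cases hz : z ∈ stateSpace M n
  · exact hB ⟨z, hz, rfl⟩
  · simp [totalRate, rate, hz]

lemma exists_abs_cost_le : ∃ C : ℝ, ∀ z e, |cost M z e| ≤ C := by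
  refine ⟨|M.beta| + |M.gamma1| + |M.gamma2| + |M.gamma3| + |M.gamma4|, fun z e => ?_⟩
  have h0 := abs_nonneg M.beta
  have h1 := abs_nonneg M.gamma1
  have h2 := abs_nonneg M.gamma2
  have h3 := abs_nonneg M.gamma3
  have h4 := abs_nonneg M.gamma4
  cases e <;> simp only [cost] <;> (try split_ifs) <;> (try rw [abs_zero]) <;> linarith

variable {M n}

/-- The weights `rate e / |R + s|` sum to at most `R / (R + Re s)`, which is increasing in `R`. -/
lemma norm_discountedStep_le {B : ℝ≥0} (hB : ∀ z, totalRate M n z ≤ B) {s : ℂ} (hs : 0 < s.re)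
    {w : Event × State → ℂ} {C : ℝ} (hw : ∀ p, ‖w p‖ ≤ C) (z : State) :
    ‖discountedStep M n s w z‖ ≤ B / (B + s.re) * C := by
  have hC : 0 ≤ C := (norm_nonneg _).trans (hw (.arrive1, z))
  have hR : (totalRate M n z : ℝ) + s.re ≤ ‖(totalRate M n z : ℂ) + s‖ := by
    simpa using Complex.re_le_norm ((totalRate M n z : ℂ) + s)
  have hpos : 0 < (totalRate M n z : ℝ) + s.re := by positivity
  calc ‖discountedStep M n s w z‖
      ≤ ∑ e, (rate M n z e : ℝ) / (totalRate M n z + s.re) * C := by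
        refine (norm_sum_le _ _).trans (Finset.sum_le_sum fun e _ => ?_)
        rw [norm_mul, norm_div]
        gcongr
        · simp
        · exact hw _
    _ = totalRate M n z / (totalRate M n z + s.re) * C := by
        rw [← Finset.sum_mul, ← Finset.sum_div, totalRate, NNReal.coe_sum]
    _ ≤ B / (B + s.re) * C := by
        have h1 : (totalRate M n z : ℝ) ≤ B := by exact_mod_cast hB z
        have h2 : (0 : ℝ) < B + s.re := by positivity
        refine mul_le_mul_of_nonneg_right ?_ hC
        rw [div_le_div_iff₀ hpos h2]
        nlinarith

lemma norm_discountedMean_le {B : ℝ≥0} (hB : ∀ z, totalRate M n z ≤ B) {s : ℂ} (hs : 0 < s.re)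
    {w : Event × State → ℂ} {C : ℝ} (hw : ∀ p, ‖w p‖ ≤ C) (i : ℕ) (z : State) :
    ‖discountedMean M n s w i z‖ ≤ (B / (B + s.re)) ^ (i + 1) * C := by
  induction i generalizing w C with
  | zero =>
    rw [discountedMean_zero M n hs, zero_add, pow_one]
    exact norm_discountedStep_le hB hs hw z
  | succ i ih =>
    rw [discountedMean_succ M n hs hw, pow_succ, mul_assoc]
    exact ih fun p => norm_discountedStep_le hB hs hw _

/-- Peeling off the first step instead of the last. Both describe powers of one operator, so
induction over all bounded `w` converts `discountedMean_succ` into this form, and no shift of the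
path measure is needed. -/
lemma discountedMean_succ_eq_discountedStep {s : ℂ} (hs : 0 < s.re) {w : Event × State → ℂ}
    {C : ℝ} (hw : ∀ p, ‖w p‖ ≤ C) (i : ℕ) :
    discountedMean M n s w (i + 1) =
      discountedStep M n s (fun p => discountedMean M n s w i (next M n p.2 p.1)) := by
  obtain ⟨B, hB⟩ := exists_totalRate_le M n
  induction i generalizing w C with
  | zero => rw [discountedMean_succ M n hs hw, discountedMean_zero M n hs,
      discountedMean_zero M n hs]
  | succ i ih =>
    rw [discountedMean_succ M n hs hw,
      ih (fun p => norm_discountedStep_le hB hs hw (next M n p.2 p.1)),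
      discountedMean_succ M n hs hw]

lemma discount_ratio_lt_one (B : ℝ≥0) {σ : ℝ} (hσ : 0 < σ) : (B : ℝ) / (B + σ) < 1 := by
  rw [div_lt_one (by positivity)]
  linarith

lemma summable_ratio_pow (B : ℝ≥0) {σ : ℝ} (hσ : 0 < σ) (C : ℝ) :
    Summable fun i : ℕ => ((B : ℝ) / (B + σ)) ^ (i + 1) * C :=
  (((summable_nat_add_iff 1).mpr (summable_geometric_of_lt_one (by positivity)
    (discount_ratio_lt_one B hσ)))).mul_right C

lemma summable_discountedMean {s : ℂ} (hs : 0 < s.re) {w : Event × State → ℂ} {C : ℝ}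
    (hw : ∀ p, ‖w p‖ ≤ C) (z : State) : Summable fun i => discountedMean M n s w i z := by
  obtain ⟨B, hB⟩ := exists_totalRate_le M n
  exact (summable_ratio_pow B hs C).of_norm_bounded fun i => norm_discountedMean_le hB hs hw i z

/-- First step analysis of the total discounted expectation. -/
lemma tsum_discountedMean {s : ℂ} (hs : 0 < s.re) {w : Event × State → ℂ} {C : ℝ}
    (hw : ∀ p, ‖w p‖ ≤ C) (z : State) :
    ∑' i, discountedMean M n s w i z =
      discountedStep M n s
        (fun p => w p + ∑' i, discountedMean M n s w i (next M n p.2 p.1)) z := by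
  rw [(summable_discountedMean hs hw z).tsum_eq_zero_add, discountedMean_zero M n hs]
  simp only [discountedMean_succ_eq_discountedStep hs hw, discountedStep, mul_add,
    Finset.sum_add_distrib]
  congr 1
  rw [Summable.tsum_finsetSum
    fun e _ => (summable_discountedMean hs hw (next M n z e)).mul_left _]
  simp only [tsum_mul_left]

/-! ### Costs during `(0, t)`, their expectations and Laplace transforms. -/

section CostTerm

variable (M n)

lemma measurable_costTerm_prod (i : ℕ) :
    Measurable fun p : ℝ × (ℕ → Step) => costTerm M p.1 p.2 i := by
  unfold costTerm
  have h : Measurable fun p : Event × State => cost M p.2 p.1 := measurable_of_countable _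
  have h' : Measurable fun p : ℝ × (ℕ → Step) => cost M (p.2 i).2.2 (p.2 i).2.1 :=
    h.comp (by fun_prop : Measurable fun p : ℝ × (ℕ → Step) => (p.2 i).2)
  refine Measurable.ite (measurableSet_lt ?_ ?_) h' measurable_const
  · exact (measurable_eventTime i).comp measurable_snd
  · fun_prop

lemma measurable_costTerm (t : ℝ) (i : ℕ) : Measurable fun ω => costTerm M t ω i :=
  (measurable_costTerm_prod M i).comp measurable_prodMk_left

variable {M}

lemma abs_costTerm_le {C : ℝ} (hC : ∀ z e, |cost M z e| ≤ C) (t : ℝ) (ω : ℕ → Step) (i : ℕ) :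
    |costTerm M t ω i| ≤ C := by
  unfold costTerm
  split_ifs
  · exact hC _ _
  · simpa using (abs_nonneg _).trans (hC ⟨0, 0, 0, 0, 0, 0, 0⟩ .arrive1)

/-- An exponential Markov bound: if the event time `τ` is less than `t`, then `1 ≤ exp (σ (t - τ))`.
It trades the cutoff at `t` for a discount, to which the geometric estimate applies. -/
lemma abs_costTerm_le_discount {C : ℝ} (hC : ∀ z e, |cost M z e| ≤ C) {σ : ℝ} (hσ : 0 < σ)
    (t : ℝ) (ω : ℕ → Step) (i : ℕ) :
    |costTerm M t ω i| ≤ C * Real.exp (σ * t) * ‖discount σ (eventTime ω i)‖ := by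
  have hC0 : 0 ≤ C := (abs_nonneg _).trans (hC ⟨0, 0, 0, 0, 0, 0, 0⟩ .arrive1)
  unfold costTerm
  split_ifs with h
  · have htop : eventTime ω i ≠ ⊤ := h.ne_top
    rw [ENNReal.lt_ofReal_iff_toReal_lt htop] at h
    rw [norm_discount, if_neg htop, Complex.ofReal_re, mul_assoc, ← Real.exp_add]
    have h1 : 1 ≤ Real.exp (σ * t + -σ * (eventTime ω i).toReal) := by
      rw [Real.one_le_exp_iff]
      nlinarith
    exact (hC _ _).trans (le_mul_of_one_le_right hC0 h1)
  · rw [abs_zero]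
    positivity

lemma integrable_costTerm (t : ℝ) (i : ℕ) (z : State) :
    Integrable (fun ω => costTerm M t ω i) (chainLaw M n z) := by
  obtain ⟨C, hC⟩ := exists_abs_cost_le M
  exact Integrable.of_bound (measurable_costTerm M t i).aestronglyMeasurable C
    (.of_forall fun ω => abs_costTerm_le hC t ω i)

variable {n}

/-- The case `w = 1` of `norm_discountedMean_le`; at real `σ` the discount equals its norm. -/
lemma integral_norm_discount_le {B : ℝ≥0} (hB : ∀ z, totalRate M n z ≤ B) {σ : ℝ} (hσ : 0 < σ)
    (i : ℕ) (z : State) :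
    ∫ ω, ‖discount σ (eventTime ω i)‖ ∂(chainLaw M n z) ≤ (B / (B + σ)) ^ (i + 1) := by
  have h := norm_discountedMean_le hB (s := (σ : ℂ)) (by simpa using hσ)
    (w := fun _ => 1) (C := 1) (by simp) i z
  simp only [discountedMean, mul_one, Complex.ofReal_re] at h
  have h2 : ∀ ω : ℕ → Step,
      discount (σ : ℂ) (eventTime ω i) = (‖discount σ (eventTime ω i)‖ : ℂ) := fun ω => by
    simpa using discount_ofReal_re (σ : ℂ) (eventTime ω i)
  rw [integral_congr_ae (.of_forall h2), integral_complex_ofReal, Complex.norm_real,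
    Real.norm_eq_abs] at h
  exact (le_abs_self _).trans h

lemma integral_norm_costTerm_le {C : ℝ} (hC : ∀ z e, |cost M z e| ≤ C) {B : ℝ≥0}
    (hB : ∀ z, totalRate M n z ≤ B) {σ : ℝ} (hσ : 0 < σ) (t : ℝ) (i : ℕ) (z : State) :
    ∫ ω, ‖costTerm M t ω i‖ ∂(chainLaw M n z) ≤
      (B / (B + σ)) ^ (i + 1) * (C * Real.exp (σ * t)) := by
  have hC0 : 0 ≤ C := (abs_nonneg _).trans (hC z .arrive1)
  have hi : Integrable (fun ω => ‖discount σ (eventTime ω i)‖) (chainLaw M n z) := by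
    refine Integrable.of_bound (C := 1) (by fun_prop : Measurable _).aestronglyMeasurable (.of_forall fun ω => ?_)
    rw [norm_norm]
    exact norm_discount_le_one (by simpa using hσ) _
  calc _ ≤ ∫ ω, C * Real.exp (σ * t) * ‖discount σ (eventTime ω i)‖ ∂(chainLaw M n z) :=
        integral_mono (integrable_costTerm n t i z).norm (hi.const_mul _)
          fun ω => abs_costTerm_le_discount hC hσ t ω i
    _ ≤ _ := by
        rw [integral_const_mul, mul_comm]
        gcongr
        exact integral_norm_discount_le hB hσ i z

lemma summable_integral_norm_costTerm (t : ℝ) (z : State) :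
    Summable fun i => ∫ ω, ‖costTerm M t ω i‖ ∂(chainLaw M n z) := by
  obtain ⟨C, hC⟩ := exists_abs_cost_le M
  obtain ⟨B, hB⟩ := exists_totalRate_le M n
  -- For fixed `t` any positive discount rate would do; here it is 1.
  exact (summable_ratio_pow B one_pos _).of_nonneg_of_le
    (fun i => integral_nonneg fun _ => norm_nonneg _)
    fun i => integral_norm_costTerm_le hC hB one_pos t i z

variable (M n)

lemma ae_summable_costTerm_and_integrable_totalCost (z : State) (t : ℝ) :
    (∀ᵐ ω ∂(chainLaw M n z), Summable (costTerm M t ω)) ∧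
      Integrable (totalCost M t) (chainLaw M n z) :=
  ae_summable_and_integrable_tsum (fun i => integrable_costTerm n t i z)
    (summable_integral_norm_costTerm t z)

/-- The expected cost of the event number `i` during `(0, t)`. -/
def meanCostTerm (z : State) (i : ℕ) (t : ℝ) : ℝ :=
  ∫ ω, costTerm M t ω i ∂(chainLaw M n z)

lemma hasSum_meanCostTerm (z : State) (t : ℝ) :
    HasSum (fun i => meanCostTerm M n z i t) (expectedCost M n z t) :=
  hasSum_integral_of_summable_integral_norm (fun i => integrable_costTerm n t i z)
    (summable_integral_norm_costTerm t z)

lemma measurable_meanCostTerm (z : State) (i : ℕ) : Measurable (meanCostTerm M n z i) :=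
  ((measurable_costTerm_prod M i).stronglyMeasurable.integral_prod_right').measurable

variable {M n}

lemma abs_meanCostTerm_le {C : ℝ} (hC : ∀ z e, |cost M z e| ≤ C) {B : ℝ≥0}
    (hB : ∀ z, totalRate M n z ≤ B) {σ : ℝ} (hσ : 0 < σ) (t : ℝ) (i : ℕ) (z : State) :
    |meanCostTerm M n z i t| ≤ (B / (B + σ)) ^ (i + 1) * (C * Real.exp (σ * t)) :=
  (norm_integral_le_integral_norm _).trans (integral_norm_costTerm_le hC hB hσ t i z)

/-- The choice `σ = Re s / 2` spends half of the decay of `exp (-s t)` on summability in `i` and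
keeps the other half for integrability in `t`. -/
lemma norm_exp_mul_meanCostTerm_le {C : ℝ} (hC : ∀ z e, |cost M z e| ≤ C) {B : ℝ≥0}
    (hB : ∀ z, totalRate M n z ≤ B) {s : ℂ} (hs : 0 < s.re) (t : ℝ) (i : ℕ) (z : State) :
    ‖Complex.exp (-s * t) * meanCostTerm M n z i t‖ ≤
      (B / (B + s.re / 2)) ^ (i + 1) * C * Real.exp (-(s.re / 2) * t) := by
  rw [norm_mul, Complex.norm_exp, Complex.norm_real, Real.norm_eq_abs]
  have h := abs_meanCostTerm_le hC hB (half_pos hs) t i z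
  calc _ ≤ Real.exp (-s * t).re *
        ((B / (B + s.re / 2)) ^ (i + 1) * (C * Real.exp (s.re / 2 * t))) := by gcongr
    _ = (B / (B + s.re / 2)) ^ (i + 1) * C *
        (Real.exp (-s * t).re * Real.exp (s.re / 2 * t)) := by ring
    _ = _ := by
        rw [← Real.exp_add]
        congr 2
        simp
        ring

lemma integrableOn_exp_mul_meanCostTerm {s : ℂ} (hs : 0 < s.re) (z : State) (i : ℕ) :
    IntegrableOn (fun t : ℝ => Complex.exp (-s * t) * meanCostTerm M n z i t) (Set.Ioi 0) := by
  obtain ⟨C, hC⟩ := exists_abs_cost_le M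
  obtain ⟨B, hB⟩ := exists_totalRate_le M n
  have hm := measurable_meanCostTerm M n z i
  refine Integrable.mono' ((integrableOn_exp_mul_Ioi (a := -(s.re / 2)) (by linarith) 0).const_mul
    ((B / (B + s.re / 2)) ^ (i + 1) * C)) (by fun_prop) (.of_forall fun t => ?_)
  exact norm_exp_mul_meanCostTerm_le hC hB hs t i z

lemma summable_integral_norm_exp_mul_meanCostTerm {s : ℂ} (hs : 0 < s.re) (z : State) :
    Summable fun i =>
      ∫ t in Set.Ioi (0 : ℝ), ‖Complex.exp (-s * t) * meanCostTerm M n z i t‖ := by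
  obtain ⟨C, hC⟩ := exists_abs_cost_le M
  obtain ⟨B, hB⟩ := exists_totalRate_le M n
  refine ((summable_ratio_pow B (half_pos hs) C).mul_right
    (∫ t in Set.Ioi (0 : ℝ), Real.exp (-(s.re / 2) * t))).of_nonneg_of_le
    (fun i => integral_nonneg fun _ => norm_nonneg _) fun i => ?_
  rw [← integral_const_mul]
  exact integral_mono (integrableOn_exp_mul_meanCostTerm hs z i).norm
    ((integrableOn_exp_mul_Ioi (by linarith) 0).const_mul _)
    fun t => norm_exp_mul_meanCostTerm_le hC hB hs t i z

lemma tsum_exp_mul_meanCostTerm (s : ℂ) (z : State) (t : ℝ) :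
    ∑' i, Complex.exp (-s * t) * (meanCostTerm M n z i t : ℂ) =
      Complex.exp (-s * t) * expectedCost M n z t := by
  rw [tsum_mul_left, (Complex.hasSum_ofReal.mpr (hasSum_meanCostTerm M n z t)).tsum_eq]

lemma integrableOn_exp_mul_expectedCost {s : ℂ} (hs : 0 < s.re) (z : State) :
    IntegrableOn (fun t : ℝ => Complex.exp (-s * t) * (expectedCost M n z t : ℂ))
      (Set.Ioi 0) := by
  have h := (ae_summable_and_integrable_tsum
    (fun i => integrableOn_exp_mul_meanCostTerm (M := M) (n := n) hs z i)
    (summable_integral_norm_exp_mul_meanCostTerm hs z)).2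
  simp only [tsum_exp_mul_meanCostTerm] at h
  exact h

/-- Fubini moves the time integral inside the expectation, where `integral_exp_indicator` evaluates
it path by path. -/
lemma integral_exp_mul_meanCostTerm {s : ℂ} (hs : 0 < s.re) (z : State) (i : ℕ) :
    ∫ t in Set.Ioi (0 : ℝ), Complex.exp (-s * t) * (meanCostTerm M n z i t : ℂ) =
      discountedMean M n s (fun p => cost M p.2 p.1) i z / s := by
  obtain ⟨C, hC⟩ := exists_abs_cost_le M
  have hm := measurable_costTerm_prod M i
  have hint : Integrable (fun p : ℝ × (ℕ → Step) =>
      Complex.exp (-s * p.1) * (costTerm M p.1 p.2 i : ℂ))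
      ((volume.restrict (Set.Ioi 0)).prod (chainLaw M n z)) := by
    have h1 : Integrable (fun t : ℝ => Real.exp (-s.re * t)) (volume.restrict (Set.Ioi 0)) :=
      integrableOn_exp_mul_Ioi (by linarith) 0
    refine Integrable.mono' ((h1.mul_const C).comp_fst (chainLaw M n z)) (by fun_prop)
      (.of_forall fun p => ?_)
    rw [norm_mul, Complex.norm_exp, Complex.norm_real, Real.norm_eq_abs]
    have h2 := abs_costTerm_le hC p.1 p.2 i
    have h3 : (-s * (p.1 : ℂ)).re = -s.re * p.1 := by simp
    rw [h3]
    gcongr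
  calc _ = ∫ t in Set.Ioi (0 : ℝ), ∫ ω, Complex.exp (-s * t) * (costTerm M t ω i : ℂ)
        ∂(chainLaw M n z) := by
        simp_rw [integral_const_mul, integral_complex_ofReal]
        rfl
    _ = ∫ ω, (∫ t in Set.Ioi (0 : ℝ), Complex.exp (-s * t) * (costTerm M t ω i : ℂ))
        ∂(chainLaw M n z) := integral_integral_swap hint
    _ = ∫ ω, discount s (eventTime ω i) * (cost M (ω i).2.2 (ω i).2.1 : ℂ) / s
        ∂(chainLaw M n z) := by
        refine integral_congr_ae (.of_forall fun ω => ?_)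
        have h : ∀ t : ℝ, Complex.exp (-s * t) * (costTerm M t ω i : ℂ) =
            (if eventTime ω i < ENNReal.ofReal t then Complex.exp (-s * t) else 0) *
              cost M (ω i).2.2 (ω i).2.1 := fun t => by
          unfold costTerm
          split_ifs <;> simp
        simp only [h]
        rw [integral_mul_const, integral_exp_indicator hs]
        ring
    _ = _ := integral_div _ _

lemma laplaceCost_eq_tsum {s : ℂ} (hs : 0 < s.re) (z : State) :
    laplaceCost M n s z = (∑' i, discountedMean M n s (fun p => cost M p.2 p.1) i z) / s := by
  have h := hasSum_integral_of_summable_integral_norm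
    (fun i => integrableOn_exp_mul_meanCostTerm (M := M) (n := n) hs z i)
    (summable_integral_norm_exp_mul_meanCostTerm hs z)
  simp only [tsum_exp_mul_meanCostTerm, integral_exp_mul_meanCostTerm hs] at h
  rw [laplaceCost, laplace, ← h.tsum_eq, tsum_div_const]

/-- The backward equation: the first event determines the Laplace transform. -/
lemma laplaceCost_eq_sum {s : ℂ} (hs : 0 < s.re) (z : State) :
    (totalRate M n z + s) * laplaceCost M n s z =
      ∑ e, (rate M n z e : ℂ) * (laplaceCost M n s (next M n z e) + cost M z e / s) := by
  obtain ⟨C, hC⟩ := exists_abs_cost_le M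
  have hne : (totalRate M n z : ℂ) + s ≠ 0 := by
    intro h
    have h' := congrArg Complex.re h
    simp at h'
    have : (0 : ℝ) ≤ totalRate M n z := (totalRate M n z).2
    linarith
  rw [laplaceCost_eq_tsum hs z, tsum_discountedMean hs (C := C)
    (fun p => by rw [Complex.norm_real]; exact hC _ _), discountedStep, Finset.sum_div,
    Finset.mul_sum]
  refine Finset.sum_congr rfl fun e _ => ?_
  rw [laplaceCost_eq_tsum hs]
  have hs0 : s ≠ 0 := by
    rintro rfl
    simp at hs
  field_simp
  ring

end CostTerm

end

/-! ### The backward equation in explicit form. -/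

section

lemma sum_event (f : Event → ℂ) :
    ∑ e, f e = f .arrive1 + f .arrive2 + f .arrive3 + f .arrive4
      + f .serve1 + f .serve2 + f .serve3 + f .serve4
      + f .serveUp1 + f .serveUp2 + f .serveUp3
      + f .abandon1 + f .abandon2 + f .abandon3 + f .abandon4 := by
  have h : (Finset.univ : Finset Event) = {.arrive1, .arrive2, .arrive3, .arrive4, .serve1,
    .serve2, .serve3, .serve4, .serveUp1, .serveUp2, .serveUp3, .abandon1, .abandon2, .abandon3,
    .abandon4} := rfl
  rw [h]
  simp [add_assoc]

variable {M : CallCentre} {n : Reservation}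

lemma laplaceCost_of_notMem {s : ℂ} (hs : 0 < s.re) {z : State} (hz : z ∉ stateSpace M n) :
    laplaceCost M n s z = 0 := by
  have hs0 : s ≠ 0 := by
    rintro rfl
    simp at hs
  have h := laplaceCost_eq_sum (M := M) (n := n) hs z
  simpa [totalRate, rate, hz, hs0] using h

lemma laplaceCost_of_mem (hn : n.Admissible M) {s : ℂ} (hs : 0 < s.re) {z : State}
    (hz : z ∈ stateSpace M n) :
    psi M s z ≠ 0 ∧ psi M s z * laplaceCost M n s z = xi M n s (laplaceCost M n s) z := by
  have hs0 : s ≠ 0 := by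
    rintro rfl
    simp at hs
  have h := laplaceCost_eq_sum (M := M) (n := n) hs z
  have hR : (totalRate M n z : ℂ) = ∑ e, (rate M n z e : ℂ) := by
    rw [totalRate]
    push_cast
    rfl
  rw [hR, sum_event, sum_event] at h
  simp only [rate, if_pos hz, next, cost] at h
  obtain ⟨hn2, hn3, hn4⟩ := hn
  obtain ⟨⟨h1, h2, h3⟩, ⟨h4, h5, h6⟩, ⟨h7, h8, h9⟩⟩ := served_bounds hz
  obtain ⟨ha, hb, hc, hd, htot, -⟩ := hz
  obtain ⟨a, a1, b, b1, c, c1, d⟩ := z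
  simp only [State.total] at *
  -- On `Ω` all integer multiplicities are nonnegative. Naming them as naturals makes the
  -- `Int.toNat` in `rate` agree with the integer casts in `psi` and `xi`.
  obtain ⟨m1, hm1⟩ := Int.eq_ofNat_of_zero_le (show 0 ≤ min (M.k1 : ℤ) (a - a1) by omega)
  obtain ⟨m2, hm2⟩ := Int.eq_ofNat_of_zero_le (show 0 ≤ min (b - b1) (M.k2 - a1) by omega)
  obtain ⟨m3, hm3⟩ := Int.eq_ofNat_of_zero_le (show 0 ≤ min (c - c1) (M.k3 - b1) by omega)
  obtain ⟨m4, hm4⟩ := Int.eq_ofNat_of_zero_le (show 0 ≤ min d (M.k4 - c1) by omega)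
  obtain ⟨w1, hw1⟩ := Int.eq_ofNat_of_zero_le (le_max_left 0 (a - (M.k1 + a1)))
  obtain ⟨w2, hw2⟩ := Int.eq_ofNat_of_zero_le (le_max_left 0 (b - (M.k2 - a1 + b1)))
  obtain ⟨w3, hw3⟩ := Int.eq_ofNat_of_zero_le (le_max_left 0 (c - (M.k3 - b1 + c1)))
  obtain ⟨w4, hw4⟩ := Int.eq_ofNat_of_zero_le (le_max_left 0 (d - (M.k4 - c1)))
  have ha1 : ((a1.toNat : ℤ) : ℂ) = a1 := by rw [Int.toNat_of_nonneg h1]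
  have hb1 : ((b1.toNat : ℤ) : ℂ) = b1 := by rw [Int.toNat_of_nonneg h4]
  have hc1 : ((c1.toNat : ℤ) : ℂ) = c1 := by rw [Int.toNat_of_nonneg h7]
  rw [Int.cast_natCast] at ha1 hb1 hc1
  simp only [psi, xi]
  simp only [hm1, hm2, hm3, hm4, hw1, hw2, hw3, hw4, ← ha1, ← hb1, ← hc1] at h ⊢
  constructor
  -- The real part of `psi` is a sum of nonnegative terms and `Re s > 0`.
  · intro h0
    have h0' := congrArg Complex.re h0
    by_cases hlt : a + b + c + d < M.cap <;>
      simp [ind, hlt] at h0' <;> exact absurd h0' (by positivity)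
  · rcases htot.lt_or_eq with hlt | heq
    · simp only [hlt, if_true, ind, hlt.ne, if_false] at h ⊢
      push_cast at h ⊢
      simp only [Int.toNat_natCast] at h
      linear_combination h
    -- In a full system an arrival leaves the state unchanged, so the arrival rates times
    -- `laplaceCost` at the current state cancel from both sides. Only the blocking cost, the total
    -- arrival rate times `beta / s`, remains.
    · simp only [heq, lt_irrefl, if_true, ind, if_false] at h ⊢
      push_cast at h ⊢
      simp only [Int.toNat_natCast] at h
      linear_combination h

end

end FourLevel

end

theorem mainTheorem2 (M : FourLevel.CallCentre) (n : FourLevel.Reservation)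
    (hn : n.Admissible M) :
    (∀ (z : FourLevel.State) (t : ℝ),
      (∀ᵐ ω ∂(FourLevel.chainLaw M n z), Summable (FourLevel.costTerm M t ω)) ∧
      MeasureTheory.Integrable (FourLevel.totalCost M t) (FourLevel.chainLaw M n z)) ∧
    ∀ s : ℂ, 0 < s.re →
      (∀ z : FourLevel.State, MeasureTheory.IntegrableOn
        (fun t : ℝ => Complex.exp (-s * t) * (FourLevel.expectedCost M n z t : ℂ))
        (Set.Ioi 0)) ∧
      (∀ z ∈ FourLevel.stateSpace M n,
        FourLevel.psi M s z ≠ 0 ∧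
        FourLevel.laplaceCost M n s z =
          FourLevel.xi M n s (FourLevel.laplaceCost M n s) z / FourLevel.psi M s z) ∧
      (∀ z ∉ FourLevel.stateSpace M n, FourLevel.laplaceCost M n s z = 0) := by
  refine ⟨fun z t => FourLevel.ae_summable_costTerm_and_integrable_totalCost M n z t,
    fun s hs => ⟨fun z => FourLevel.integrableOn_exp_mul_expectedCost hs z, fun z hz => ?_,
      fun z hz => FourLevel.laplaceCost_of_notMem hs hz⟩⟩
  obtain ⟨h1, h2⟩ := FourLevel.laplaceCost_of_mem hn hs hz
  exact ⟨h1, by rw [eq_div_iff h1, mul_comm, h2]⟩
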